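/- **Setting.** All systems are finite-dimensional. Alice has a private memory $R_A$, Bob has a private memory $R_B$, and they exchange a message system $A$. In an $N$-round protocol, Alice prepares a pure state of $R_AA$, and Bob's memory starts in a fixed basis state $|0\rangle$. In each round $\ell=1,\dots,N$, Alice sends $A$ to Bob, Bob applies a unitary $U_{x,\ell}$ to $AR_B$, depending on his data bits $x=(x_0,x_1)\in\{0,1\}^2$, and returns $A$, and then Alice applies a unitary $V_\ell$ to $R_AA$. Finally, Alice makes a projective accept/abort measurement on $R_AA$, Bob makes a projective accept/abort measurement (which may depend on $x$) on $R_B$, and, if Alice accepts, she measures a POVM on $R_AA$ to obtain her output. * In a *semi-random oblivious transfer protocol* Alice has no input and her output is $(i,\hat x)\in\{0,1\}^2$. It has *$\delta$-completeness* if for every $x$, when both parties are honest, both accept with probability $1$, $\Pr[i=0]=\Pr[i=1]=\tfrac12$, and $\Pr[\hat x=x_i]\ge 1-\delta$. * In a *standard oblivious transfer protocol* Alice has an input bit $i$, on which her initial state, unitaries and measurements may depend, and her output is a bit $\hat x$. It has *$\delta$-completeness* if for all $i$ and $x$, when both parties are honest, both accept with probability $1$ and $\Pr[\hat x=x_i]\ge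 1-\delta$. A cheating party may use any finite-dimensional memory, any initial state of the systems it prepares, any unitaries in its turns, and any final POVM on the systems it holds to produce its guess. * *$P_A^\star$-soundness against a cheating Alice*: if Bob is honest and $(x_0,x_1)$ is uniformly random, then for every cheating Alice with guess $(\hat x_0,\hat x_1)$, $\Pr[(\hat x_0,\hat x_1)=(x_0,x_1)\ \text{and Bob accepts}]\le P_A^\star$. * *$P_B^\star$-soundness against a cheating Bob*: if Alice is honest (and, for a standard protocol, her input $i$ is uniformly random), then for every cheating Bob with guess $\hat i$, $\Pr[\hat i=i\ \text{and Alice accepts}]\le P_B^\star$. **Theorem.** Let $\delta,P_A^\star,P_B^\star$ be real numbers. Every semi-random oblivious transfer protocol and every standard oblivious transfer protocol with $\delta$-completeness, $P_A^\star$-soundness against a cheating Alice and $P_B^\star$-soundness against a cheating Bob satisfies $$P_A^\star+2P_B^\star+4\sqrt{\delta}\ \ge\ 2 .$$ -/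

import Mathlib

open scoped Matrix Kronecker ComplexOrder

namespace QOT

/-- A bit. -/
abbrev Bit := Fin 2

/-- Bob's two data bits: `x 0` is `x₀` and `x 1` is `x₁`. -/
abbrev DataBits := Bit → Bit

section Basics

variable {S RA A RB : Type} [Fintype S] [DecidableEq S] [Fintype RA] [DecidableEq RA]
  [Fintype A] [DecidableEq A] [Fintype RB] [DecidableEq RB]

/-- A positive operator valued measure with outcomes in `ι` on the finite-dimensional Hilbert
space with orthonormal basis `S`. -/
structure POVM (ι : Type) [Fintype ι] (S : Type) [Fintype S] [DecidableEq S] where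
  /-- The effect of each outcome. -/
  effect : ι → Matrix S S ℂ
  posSemidef : ∀ k, (effect k).PosSemidef
  sum_eq_one : ∑ k, effect k = 1

/-- The operator `X ⊗ Y` on the joint space of Alice's memory, the message and Bob's memory, with
`X` acting on Alice's memory and the message, and `Y` on Bob's memory. -/
def aliceBob (X : Matrix (RA × A) (RA × A) ℂ) (Y : Matrix RB RB ℂ) :
    Matrix (RA × A × RB) (RA × A × RB) ℂ :=
  Matrix.reindex (Equiv.prodAssoc RA A RB) (Equiv.prodAssoc RA A RB) (X ⊗ₖ Y)

/-- The operator `1 ⊗ Y` on the joint space, with `Y` acting on the message and Bob's memory. -/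
def onBob (Y : Matrix (A × RB) (A × RB) ℂ) : Matrix (RA × A × RB) (RA × A × RB) ℂ :=
  (1 : Matrix RA RA ℂ) ⊗ₖ Y

/-- The Born rule: the probability `⟨φ| E |φ⟩` of the effect `E` in the pure state `φ`. -/
noncomputable def prob (φ : S → ℂ) (E : Matrix S S ℂ) : ℝ :=
  (star φ ⬝ᵥ (E *ᵥ φ)).re

end Basics

/-- What Alice does during `N` rounds of communication, with message system `A` and private memory
`RA`: she prepares the pure state `init` of memory and message; after Bob's reply in each round
`ℓ` she applies the unitary `V ℓ` to memory and message. -/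
structure AliceProgram (N : ℕ) (A RA : Type) [Fintype A] [DecidableEq A] [Fintype RA]
    [DecidableEq RA] where
  init : RA × A → ℂ
  init_unit : star init ⬝ᵥ init = 1
  V : Fin N → Matrix.unitaryGroup (RA × A) ℂ

/-- What Bob does during `N` rounds of communication, with message system `A` and private memory
`RB`: he prepares the pure state `init` of his memory; in each round `ℓ` he applies the unitary
`U ℓ` to the received message and his memory, and returns the message system. -/
structure BobProgram (N : ℕ) (A RB : Type) [Fintype A] [DecidableEq A] [Fintype RB]
    [DecidableEq RB] where
  init : RB → ℂ
  init_unit : star init ⬝ᵥ init = 1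
  U : Fin N → Matrix.unitaryGroup (A × RB) ℂ

section Interaction

variable {N : ℕ} {A RA RB : Type} [Fintype A] [DecidableEq A] [Fintype RA] [DecidableEq RA]
  [Fintype RB] [DecidableEq RB]

/-- The joint pure state of Alice's memory, the message and Bob's memory after `ℓ` rounds. -/
noncomputable def stateAfter (a : AliceProgram N A RA) (b : BobProgram N A RB) :
    (ℓ : ℕ) → ℓ ≤ N → (RA × A × RB → ℂ)
  | 0, _ => fun s => a.init (s.1, s.2.1) * b.init s.2.2
  | ℓ + 1, h =>
      aliceBob (a.V ⟨ℓ, h⟩ : Matrix (RA × A) (RA × A) ℂ) (1 : Matrix RB RB ℂ) *ᵥ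
        (onBob (b.U ⟨ℓ, h⟩ : Matrix (A × RB) (A × RB) ℂ) *ᵥ
          stateAfter a b ℓ (Nat.le_of_succ_le h))

/-- The joint pure state after all `N` rounds. -/
noncomputable def finalState (a : AliceProgram N A RA) (b : BobProgram N A RB) :
    RA × A × RB → ℂ :=
  stateAfter a b N le_rfl

end Interaction

/-- An honest Bob: his memory starts in the basis state `zero`, he uses unitaries depending on his
data bits, and finally measures `{accept x, 1 - accept x}` on his memory to decide whether he
accepts or aborts. -/
structure HonestBob (N : ℕ) (A RB : Type) [Fintype A] [DecidableEq A] [Fintype RB]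
    [DecidableEq RB] where
  zero : RB
  U : DataBits → Fin N → Matrix.unitaryGroup (A × RB) ℂ
  accept : DataBits → Matrix RB RB ℂ
  accept_proj : ∀ x, IsStarProjection (accept x)

/-- The program of an honest Bob with data bits `x`. -/
noncomputable def HonestBob.program {N : ℕ} {A RB : Type} [Fintype A] [DecidableEq A] [Fintype RB]
    [DecidableEq RB] (B : HonestBob N A RB) (x : DataBits) : BobProgram N A RB where
  init := Pi.single B.zero 1
  init_unit := by simp
  U := B.U x

/-- Soundness against a cheating Alice. Bob is honest and `x` is uniformly random. A cheating Alice
has an arbitrary finite-dimensional memory, prepares an arbitrary state, applies arbitrary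
unitaries, and finally measures an arbitrary POVM to guess both data bits. The probability that her
guess is right and Bob accepts is at most `PA`. -/
def HonestBob.SoundAgainstAlice {N : ℕ} {A RB : Type} [Fintype A] [DecidableEq A] [Fintype RB]
    [DecidableEq RB] (B : HonestBob N A RB) (PA : ℝ) : Prop :=
  ∀ (RA' : Type) [Fintype RA'] [DecidableEq RA'] (a : AliceProgram N A RA')
    (M : POVM DataBits (RA' × A)),
    (1 / 4 : ℝ) * ∑ x : DataBits,
      prob (finalState a (B.program x)) (aliceBob (M.effect x) (B.accept x)) ≤ PA

/-- A semi-random oblivious transfer protocol. After the `N` rounds Alice measures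
`{aliceAccept, 1 - aliceAccept}`; if she accepts, she measures the POVM `aliceMeas` to obtain her
output `(i, x̂)`. -/
structure SemiRandomOT (N : ℕ) (A RA RB : Type) [Fintype A] [DecidableEq A] [Fintype RA]
    [DecidableEq RA] [Fintype RB] [DecidableEq RB] where
  alice : AliceProgram N A RA
  aliceAccept : Matrix (RA × A) (RA × A) ℂ
  aliceAccept_proj : IsStarProjection aliceAccept
  aliceMeas : POVM (Bit × Bit) (RA × A)
  bob : HonestBob N A RB

namespace SemiRandomOT

variable {N : ℕ} {A RA RB : Type} [Fintype A] [DecidableEq A] [Fintype RA] [DecidableEq RA]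
  [Fintype RB] [DecidableEq RB]

/-- The effect of the event that honest Alice accepts and outputs `(i, y)`. -/
def outputEffect (P : SemiRandomOT N A RA RB) (i y : Bit) : Matrix (RA × A) (RA × A) ℂ :=
  P.aliceAccept * P.aliceMeas.effect (i, y) * P.aliceAccept

/-- `δ`-completeness: for all data bits of Bob, when both parties are honest, both accept with
certainty, `i` is uniformly random, and `x̂ = x i` with probability at least `1 - δ`. -/
def Complete (P : SemiRandomOT N A RA RB) (δ : ℝ) : Prop :=
  ∀ x : DataBits,
    prob (finalState P.alice (P.bob.program x)) (aliceBob P.aliceAccept (P.bob.accept x)) = 1 ∧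
    (∀ i : Bit, ∑ y : Bit,
      prob (finalState P.alice (P.bob.program x)) (aliceBob (P.outputEffect i y) 1) = 1 / 2) ∧
    1 - δ ≤ ∑ i : Bit,
      prob (finalState P.alice (P.bob.program x)) (aliceBob (P.outputEffect i (x i)) 1)

/-- Soundness against a cheating Bob. Alice is honest. A cheating Bob has an arbitrary
finite-dimensional memory, prepares an arbitrary state, applies arbitrary unitaries, and finally
measures an arbitrary POVM to guess `i`. The probability that his guess is right and Alice accepts
is at most `PB`. -/
def SoundAgainstBob (P : SemiRandomOT N A RA RB) (PB : ℝ) : Prop :=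
  ∀ (RB' : Type) [Fintype RB'] [DecidableEq RB'] (b : BobProgram N A RB') (M : POVM Bit RB'),
    ∑ i : Bit, ∑ y : Bit,
      prob (finalState P.alice b) (aliceBob (P.outputEffect i y) (M.effect i)) ≤ PB

end SemiRandomOT

/-- A standard oblivious transfer protocol: as for semi-random oblivious transfer, but all of
Alice's actions may depend on her input bit `i`, and her output is a bit `x̂`. -/
structure StandardOT (N : ℕ) (A RA RB : Type) [Fintype A] [DecidableEq A] [Fintype RA]
    [DecidableEq RA] [Fintype RB] [DecidableEq RB] where
  alice : Bit → AliceProgram N A RA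
  aliceAccept : Bit → Matrix (RA × A) (RA × A) ℂ
  aliceAccept_proj : ∀ i, IsStarProjection (aliceAccept i)
  aliceMeas : Bit → POVM Bit (RA × A)
  bob : HonestBob N A RB

namespace StandardOT

variable {N : ℕ} {A RA RB : Type} [Fintype A] [DecidableEq A] [Fintype RA] [DecidableEq RA]
  [Fintype RB] [DecidableEq RB]

/-- The effect of the event that honest Alice with input `i` accepts and outputs `y`. -/
def outputEffect (P : StandardOT N A RA RB) (i y : Bit) : Matrix (RA × A) (RA × A) ℂ :=
  P.aliceAccept i * (P.aliceMeas i).effect y * P.aliceAccept i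

/-- `δ`-completeness: for all inputs, when both parties are honest, both accept with certainty and
`x̂ = x i` with probability at least `1 - δ`. -/
def Complete (P : StandardOT N A RA RB) (δ : ℝ) : Prop :=
  ∀ (i : Bit) (x : DataBits),
    prob (finalState (P.alice i) (P.bob.program x))
      (aliceBob (P.aliceAccept i) (P.bob.accept x)) = 1 ∧
    1 - δ ≤ prob (finalState (P.alice i) (P.bob.program x)) (aliceBob (P.outputEffect i (x i)) 1)

/-- Soundness against a cheating Bob. Alice is honest and `i` is uniformly random. For every
strategy of a cheating Bob, the probability that his guess for `i` is right and Alice accepts is at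
most `PB`. -/
def SoundAgainstBob (P : StandardOT N A RA RB) (PB : ℝ) : Prop :=
  ∀ (RB' : Type) [Fintype RB'] [DecidableEq RB'] (b : BobProgram N A RB') (M : POVM Bit RB'),
    (1 / 2 : ℝ) * ∑ i : Bit,
      prob (finalState (P.alice i) b) (aliceBob (P.aliceAccept i) (M.effect i)) ≤ PB

end StandardOT

end QOT

/-!
The joint state of the parties is treated as a matrix with rows indexed by Alice's side and columns
by Bob's memory, so that `⟨φ| X ⊗ Y |φ⟩` becomes `tr (mᴴ X m Yᵀ)` (`prob_aliceBob`).

Fix `i` and the value `y` of `x i`, and let `v₀`, `v₁` be the honest final states for the two values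
of the other bit. Write Alice's effect for the output `(i, y)` as `Kᴴ K`. The proof plays two
cheating strategies against each other.

* Alice runs the protocol honestly, obtains `(i, y)` with Kraus operator `K`, and then discriminates
  `K v₀` from `K v₁` to learn the other bit. With `P` and `Q` the unnormalised reduced states of
  `K v₀` and `K v₁` on her side, the argument of Powers and Størmer yields a measurement with total
  error at most `tr (√P √Q)` (`exists_discriminator`). Polar decompositions of `K v₀` and `K v₁`
  rewrite this number as the real part `f i y` of `⟨v₀| Kᴴ K ⊗ C |v₁⟩`, where `C` is a contraction
  on Bob's memory (`exists_discriminator_conj`).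
* Bob runs the honest program with the other bit in uniform superposition, controlled by a qubit.
  Finally he measures the effects `½ (1 ± X)`, where `X` has off-diagonal blocks `C` and `Cᴴ` with
  respect to the control qubit. If Alice's output index is `i`, she does not learn the other bit and
  the coherence, which is `f i y` up to her rare wrong output, survives; if it is the other index,
  she knows the superposed bit almost with certainty and the coherence is of order at most `√δ`, by the
  Cauchy–Schwarz inequality (`abs_coherence_le`).

Averaging over `i` and `y`, the terms `f i y` cancel in `PA + 2 PB` (`tradeoff`). Alice's wrong
outputs cost at most `√δ` in `PA`, and the three small coherences at most `3 √δ` in `2 PB`.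

Both kinds of protocol are instances of `tradeoff`: for standard oblivious transfer the states are
scaled by `1 / √2`, which is the weight of Alice's random input.
-/

namespace QOT

/-! ### Discrimination and coherence -/

section Operators

variable {S T B : Type} [Fintype S] [Fintype T] [Fintype B]

theorem exists_eq_conjTranspose_mul_self {P : Matrix S S ℂ} (hP : P.PosSemidef) :
    ∃ K : Matrix S S ℂ, P = Kᴴ * K := by
  classical
  open scoped MatrixOrder Matrix.Norms.L2Operator in
  exact CStarAlgebra.nonneg_iff_eq_star_mul_self.mp hP.nonneg

theorem re_trace_mul_nonneg {P Q : Matrix S S ℂ} (hP : P.PosSemidef) (hQ : Q.PosSemidef) :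
    0 ≤ (P * Q).trace.re := by
  obtain ⟨K, rfl⟩ := exists_eq_conjTranspose_mul_self hP
  rw [Matrix.mul_assoc, Matrix.trace_mul_comm]
  have h := (hQ.mul_mul_conjTranspose_same K).trace_nonneg
  exact (Complex.nonneg_iff.mp h).1

theorem posSemidef_of_isStarProjection {E : Matrix S S ℂ} (hE : IsStarProjection E) :
    E.PosSemidef := by
  have h := Matrix.posSemidef_conjTranspose_mul_self E
  rwa [show Eᴴ = E from hE.isSelfAdjoint, hE.isIdempotentElem.eq] at h

/-- The spectral projection `D` of a Hermitian matrix `X` onto its positive eigenvalues, so that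
`D * X` and `D * X - X` are the positive and negative parts of `X`. -/
theorem exists_projection_positivePart [DecidableEq S] (X : Matrix S S ℂ) (hX : X.IsHermitian) :
    ∃ D : Matrix S S ℂ, D.PosSemidef ∧ (1 - D).PosSemidef ∧ D * X = X * D ∧
      (D * X).PosSemidef ∧ (D * X - X).PosSemidef := by
  open scoped MatrixOrder in
  have hc : ∀ f : ℝ → ℝ, ContinuousOn f (spectrum ℝ X) := fun f =>
    (Matrix.finite_real_spectrum (A := X)).continuousOn f
  have hX' : IsSelfAdjoint X := hX
  let g : ℝ → ℝ := fun t => if 0 < t then 1 else 0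
  have hg : ∀ t, g t * g t = g t := fun t => by simp only [g]; split_ifs <;> norm_num
  have hD : cfc g X * X = cfc (fun t => g t * t) X := by
    conv_lhs => rw [← cfc_id' ℝ X, cfc_id' ℝ X]
    rw [cfc_mul g (fun t => t) X (hc _) (hc _), cfc_id' ℝ X]
  have hD' : X * cfc g X = cfc (fun t => g t * t) X := by
    rw [show (fun t => g t * t) = fun t => t * g t from funext fun t => mul_comm _ _,
      cfc_mul (fun t => t) g X (hc _) (hc _), cfc_id' ℝ X]
  have hDD : cfc g X * cfc g X = cfc g X := by
    rw [← cfc_mul g g X (hc _) (hc _)]; simp only [hg]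
  have hP : IsStarProjection (cfc g X) := ⟨hDD, cfc_predicate g X⟩
  refine ⟨cfc g X, posSemidef_of_isStarProjection hP, posSemidef_of_isStarProjection hP.one_sub,
    hD.trans hD'.symm, ?_, ?_⟩
  · rw [hD, ← Matrix.nonneg_iff_posSemidef]
    refine cfc_nonneg fun t _ => ?_
    simp only [g]; split_ifs with h
    · simpa using h.le
    · simp
  · rw [hD]
    nth_rewrite 2 [← cfc_id' ℝ X]
    rw [← cfc_sub _ _ X (hc _) (hc _), ← Matrix.nonneg_iff_posSemidef]
    refine cfc_nonneg fun t _ => ?_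
    simp only [g]; split_ifs with h <;> simp
    exact not_lt.mp h

/-- A two-outcome measurement discriminating `R ^ 2` from `Q ^ 2` with total error at most the
overlap `tr (R Q)`, obtained from the sign of `R - Q` as in the Powers–Størmer inequality. -/
theorem exists_discriminator [DecidableEq S] {R Q : Matrix S S ℂ} (hR : R.PosSemidef)
    (hQ : Q.PosSemidef) :
    ∃ D : Matrix S S ℂ, D.PosSemidef ∧ (1 - D).PosSemidef ∧
      ((1 - D) * (R * R)).trace.re + (D * (Q * Q)).trace.re ≤ (R * Q).trace.re := by
  obtain ⟨D, h0, h1, hc, hp, hm⟩ :=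
    exists_projection_positivePart (R - Q) (hR.1.sub hQ.1)
  refine ⟨D, h0, h1, ?_⟩
  have e1 := re_trace_mul_nonneg hp hQ
  have e2 := re_trace_mul_nonneg hm hR
  have key : ((1 - D) * (R * R)).trace + (D * (Q * Q)).trace + (D * (R - Q) * Q).trace +
      ((D * (R - Q) - (R - Q)) * R).trace = (R * Q).trace := by
    -- Up to cyclicity of the trace, only the commutation of `D` with `R - Q` is needed.
    have c1 : (D * R * Q).trace = (D * Q * R).trace := by
      have h := congrArg (fun Z => (Z * R).trace) hc
      simp only [sub_mul, mul_sub, Matrix.trace_sub] at h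
      have h2 : (R * D * R).trace = (D * R * R).trace := by
        rw [mul_assoc, Matrix.trace_mul_comm]
      have h3 : (Q * D * R).trace = (D * R * Q).trace := by
        rw [mul_assoc, Matrix.trace_mul_comm]
      rw [h2, h3] at h
      linear_combination h
    have c2 : (Q * R).trace = (R * Q).trace := Matrix.trace_mul_comm _ _
    simp only [sub_mul, mul_sub, Matrix.trace_sub, one_mul, ← mul_assoc]
    linear_combination c1 + c2
  have := congrArg Complex.re key
  simp only [Complex.add_re] at this
  linarith

/-- A polar decomposition of a rectangular matrix: `a * Vᴴ` is the positive square root of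
`a * aᴴ` and `V` is a contraction. -/
theorem exists_contraction_sqrt [DecidableEq S] [DecidableEq B] (a : Matrix S B ℂ) :
    ∃ V : Matrix S B ℂ, (1 - Vᴴ * V).PosSemidef ∧ (a * Vᴴ).PosSemidef ∧
      a * Vᴴ * (a * Vᴴ) = a * aᴴ := by
  open scoped MatrixOrder in
  have hP : (a * aᴴ).PosSemidef := Matrix.posSemidef_self_mul_conjTranspose a
  generalize hPd : a * aᴴ = P at *
  have hc : ∀ f : ℝ → ℝ, ContinuousOn f (spectrum ℝ P) := fun f =>
    (Matrix.finite_real_spectrum (A := P)).continuousOn f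
  have hP' : IsSelfAdjoint P := hP.1
  have hs : ∀ t ∈ spectrum ℝ P, 0 ≤ t := spectrum_nonneg_of_nonneg hP.nonneg
  -- `(√t)⁻¹` vanishes at `0`, so that `g P` is a pseudo-inverse of the square root of `P`.
  let g : ℝ → ℝ := fun t => (√t)⁻¹
  have hgP : P * cfc g P = cfc (fun t => √t) P := by
    nth_rewrite 1 [← cfc_id' ℝ P]
    rw [← cfc_mul _ g P (hc _) (hc _)]
    refine cfc_congr fun t ht => ?_
    simp only [g]
    rw [← div_eq_mul_inv, Real.div_sqrt]
  have hgs : (cfc g P)ᴴ = cfc g P := cfc_predicate g P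
  have hproj : cfc g P * P * cfc g P * cfc g P = cfc g P := by
    rw [mul_assoc, mul_assoc, ← mul_assoc P, hgP, ← cfc_mul _ g P (hc _) (hc _),
      ← cfc_mul g _ P (hc _) (hc _)]
    refine cfc_congr fun t ht => ?_
    simp only [g]
    rcases (hs t ht).eq_or_lt with rfl | h
    · simp
    · have := Real.sqrt_pos.mpr h
      field_simp
  have hV : a * (cfc g P * a)ᴴ = cfc (fun t => √t) P := by
    rw [Matrix.conjTranspose_mul, hgs, ← Matrix.mul_assoc, hPd, hgP]
  refine ⟨cfc g P * a, ?_, ?_, ?_⟩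
  · refine posSemidef_of_isStarProjection (IsStarProjection.one_sub ⟨?_, ?_⟩)
    · change _ * _ = _
      rw [Matrix.conjTranspose_mul, hgs]
      calc aᴴ * cfc g P * (cfc g P * a) * (aᴴ * cfc g P * (cfc g P * a))
          = aᴴ * cfc g P * (cfc g P * (a * aᴴ) * cfc g P * cfc g P) * a := by
            simp only [Matrix.mul_assoc]
        _ = _ := by rw [hPd, hproj]; simp only [Matrix.mul_assoc]
    · exact (Matrix.posSemidef_conjTranspose_mul_self _).1
  · rw [hV, ← Matrix.nonneg_iff_posSemidef]
    exact cfc_nonneg fun t _ => Real.sqrt_nonneg t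
  · rw [hV, ← cfc_mul _ _ P (hc _) (hc _)]
    conv_rhs => rw [← cfc_id' ℝ P]
    exact cfc_congr fun t ht => Real.mul_self_sqrt (hs t ht)

/-- The expectation value `⟨v| O ⊗ 1 |v⟩` of an operator `O` of Alice in a joint vector, written as
a matrix `v` with rows indexed by Alice's basis and columns by Bob's. -/
noncomputable def expect (O : Matrix S S ℂ) (v : Matrix S B ℂ) : ℝ := (vᴴ * O * v).trace.re

/-- The real part of `⟨a| O ⊗ (Wᴴ * V) |b⟩`, with the operator on Bob's side acting by
transposition. -/
noncomputable def coherence (O : Matrix S S ℂ) (V W : Matrix T B ℂ) (a b : Matrix S B ℂ) : ℝ :=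
  (V * (aᴴ * O * b) * Wᴴ).trace.re

theorem expect_nonneg {O : Matrix S S ℂ} (hO : O.PosSemidef) (v : Matrix S B ℂ) :
    0 ≤ expect O v :=
  (Complex.nonneg_iff.mp (hO.conjTranspose_mul_mul_same v).trace_nonneg).1

theorem expect_add (O O' : Matrix S S ℂ) (v : Matrix S B ℂ) :
    expect (O + O') v = expect O v + expect O' v := by
  simp [expect, Matrix.mul_add, Matrix.add_mul]

theorem expect_sum {ι : Type} (s : Finset ι) (O : ι → Matrix S S ℂ) (v : Matrix S B ℂ) :
    expect (∑ i ∈ s, O i) v = ∑ i ∈ s, expect (O i) v := by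
  simp [expect, Matrix.mul_sum, Matrix.sum_mul, Matrix.trace_sum]

theorem expect_conj (K : Matrix T S ℂ) (D : Matrix T T ℂ) (v : Matrix S B ℂ) :
    expect (Kᴴ * D * K) v = (D * (K * v * (K * v)ᴴ)).trace.re := by
  rw [expect, ← Matrix.mul_assoc, Matrix.trace_mul_comm D, Matrix.trace_mul_comm]
  rw [Matrix.trace_mul_comm, Matrix.mul_assoc (K * v), Matrix.trace_mul_comm (K * v)]
  simp only [Matrix.conjTranspose_mul, Matrix.mul_assoc]

/-- An effect `Kᴴ * K` of Alice can be refined into two effects `D₀`, `D₁` that discriminate the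
joint vectors `a` and `b`, with total error at most a coherence between `a` and `b` that Bob can
observe by means of the contraction `Wᴴ * V` on his side. -/
theorem exists_discriminator_conj [DecidableEq S] [DecidableEq B] (K : Matrix S S ℂ)
    (a b : Matrix S B ℂ) :
    ∃ (D₀ D₁ : Matrix S S ℂ) (V W : Matrix S B ℂ), D₀.PosSemidef ∧ D₁.PosSemidef ∧
      D₀ + D₁ = Kᴴ * K ∧ (1 - Vᴴ * V).PosSemidef ∧ (1 - Wᴴ * W).PosSemidef ∧
      expect (Kᴴ * K) a + expect (Kᴴ * K) b - coherence (Kᴴ * K) V W a b ≤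
        expect D₀ a + expect D₁ b := by
  obtain ⟨V, hV, hR, hRR⟩ := exists_contraction_sqrt (K * a)
  obtain ⟨W, hW, hQ, hQQ⟩ := exists_contraction_sqrt (K * b)
  obtain ⟨D, h0, h1, hD⟩ := exists_discriminator hR hQ
  rw [hRR, hQQ, ← expect_conj, ← expect_conj] at hD
  have hsum : Kᴴ * D * K + Kᴴ * (1 - D) * K = Kᴴ * K := by
    simp [← Matrix.add_mul, ← Matrix.mul_add]
  have ea := expect_add (Kᴴ * D * K) (Kᴴ * (1 - D) * K) a
  have eb := expect_add (Kᴴ * D * K) (Kᴴ * (1 - D) * K) b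
  rw [hsum] at ea eb
  refine ⟨Kᴴ * D * K, Kᴴ * (1 - D) * K, V, W, h0.conjTranspose_mul_mul_same K,
    h1.conjTranspose_mul_mul_same K, hsum, hV, hW, ?_⟩
  have hf : coherence (Kᴴ * K) V W a b = (K * a * Vᴴ * (K * b * Wᴴ)).trace.re := by
    have : K * a * Vᴴ = V * (K * a)ᴴ := by
      have := hR.1.eq
      rw [← this]; simp [Matrix.mul_assoc]
    rw [this, coherence]
    simp only [Matrix.conjTranspose_mul, Matrix.mul_assoc]
  rw [hf]
  linarith

/-- The Cauchy–Schwarz inequality for the Hilbert–Schmidt inner product. -/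
theorem re_trace_conjTranspose_mul_le (X Y : Matrix S T ℂ) :
    |(Xᴴ * Y).trace.re| ≤ √(Xᴴ * X).trace.re * √(Yᴴ * Y).trace.re := by
  let x : EuclideanSpace ℂ (T × S) := WithLp.toLp 2 fun p => X p.2 p.1
  let y : EuclideanSpace ℂ (T × S) := WithLp.toLp 2 fun p => Y p.2 p.1
  have h : ∀ X Y : Matrix S T ℂ, inner ℂ (WithLp.toLp 2 fun p : T × S => X p.2 p.1 :
      EuclideanSpace ℂ (T × S)) (WithLp.toLp 2 fun p => Y p.2 p.1) = (Xᴴ * Y).trace := by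
    intro X Y
    simp [PiLp.inner_apply, Matrix.trace, Matrix.mul_apply, Fintype.sum_prod_type, mul_comm]
  rw [← h X Y, ← h X X, ← h Y Y]
  have e : ∀ z : EuclideanSpace ℂ (T × S), √(inner ℂ z z).re = ‖z‖ := fun z => by
    rw [show (inner ℂ z z).re = RCLike.re (inner ℂ z z) from rfl, ← norm_eq_sqrt_re_inner]
  rw [e, e]
  exact (Complex.abs_re_le_norm _).trans (norm_inner_le_norm x y)

/-- If Alice's effect `O` has small expectation in one of two vectors, no contraction on Bob's side
finds much coherence between them: a measurement by Alice that distinguishes the two vectors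
decoheres their superposition. -/
theorem abs_coherence_le [DecidableEq B] {O : Matrix S S ℂ} (hO : O.PosSemidef) {V W : Matrix T B ℂ}
    (hV : (1 - Vᴴ * V).PosSemidef) (hW : (1 - Wᴴ * W).PosSemidef) (a b : Matrix S B ℂ) :
    |coherence O V W a b| ≤ √(expect O a) * √(expect O b) := by
  obtain ⟨K, rfl⟩ := exists_eq_conjTranspose_mul_self hO
  have contr : ∀ (V : Matrix T B ℂ) (a : Matrix S B ℂ), (1 - Vᴴ * V).PosSemidef →
      ((K * a * Vᴴ)ᴴ * (K * a * Vᴴ)).trace.re ≤ expect (Kᴴ * K) a := by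
    intro V a hV
    have h := re_trace_mul_nonneg hV (Matrix.posSemidef_conjTranspose_mul_self (K * a))
    have e1 : ((K * a * Vᴴ)ᴴ * (K * a * Vᴴ)).trace =
        (Vᴴ * V * ((K * a)ᴴ * (K * a))).trace := by
      rw [Matrix.mul_assoc Vᴴ, Matrix.trace_mul_comm Vᴴ]
      simp [Matrix.mul_assoc]
    have e2 : expect (Kᴴ * K) a = ((K * a)ᴴ * (K * a)).trace.re := by
      simp [expect, Matrix.mul_assoc]
    rw [Matrix.sub_mul, Matrix.one_mul, Matrix.trace_sub, Complex.sub_re] at h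
    rw [e1, e2]; linarith
  have h := re_trace_conjTranspose_mul_le (K * a * Vᴴ) (K * b * Wᴴ)
  have e : (K * a * Vᴴ)ᴴ * (K * b * Wᴴ) = V * (aᴴ * (Kᴴ * K) * b) * Wᴴ := by
    simp [Matrix.mul_assoc]
  rw [e] at h
  exact h.trans (mul_le_mul (Real.sqrt_le_sqrt (contr V a hV)) (Real.sqrt_le_sqrt (contr W b hW))
    (Real.sqrt_nonneg _) (Real.sqrt_nonneg _))

end Operators

/-! ### The coherence test with a control bit -/

section ControlBit

variable {S T B : Type}

/-- The block row `[v 0, v 1]`. As a joint vector, it is `v 0 ⊗ |0⟩ + v 1 ⊗ |1⟩`, with an extra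
control bit on Bob's side. -/
def controlRow (v : Bit → Matrix S B ℂ) : Matrix S (B × Bit) ℂ :=
  Matrix.of fun s p => v p.2 s p.1

theorem controlRow_mul_blockDiagonal [Fintype B] (v : Bit → Matrix S B ℂ) (M : Bit → Matrix B B ℂ) :
    controlRow v * Matrix.blockDiagonal M = controlRow fun z => v z * M z := by
  ext s ⟨β, z⟩
  simp [controlRow, Matrix.mul_apply, Fintype.sum_prod_type, Matrix.blockDiagonal_apply]

theorem controlRow_mul_conjTranspose [Fintype B] (v : Bit → Matrix S B ℂ) (w : Bit → Matrix T B ℂ) :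
    controlRow v * (controlRow w)ᴴ = v 0 * (w 0)ᴴ + v 1 * (w 1)ᴴ := by
  ext s t
  simp [controlRow, Matrix.mul_apply, Fintype.sum_prod_type, Finset.sum_add_distrib]

theorem posSemidef_blockDiagonal [Fintype B] {M : Bit → Matrix B B ℂ} (hM : ∀ z, (M z).PosSemidef) :
    (Matrix.blockDiagonal M).PosSemidef := by
  choose K hK using fun z => exists_eq_conjTranspose_mul_self (hM z)
  rw [show M = fun z => (K z)ᴴ * K z from funext hK, Matrix.blockDiagonal_mul,
    ← Matrix.blockDiagonal_conjTranspose]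
  exact Matrix.posSemidef_conjTranspose_mul_self _

/-- The effect `½ (1 + s X)` on Bob's memory and the control bit, where `X` is off-diagonal in the
control bit, with blocks `(V 0)ᴴ * V 1` and its adjoint. It is written as a sum of two terms that
are visibly positive when `V 0` and `V 1` are contractions and `s = ±1`. -/
noncomputable def coherenceTest [Fintype T] [DecidableEq B] (V : Bit → Matrix T B ℂ) (s : ℂ) :
    Matrix (B × Bit) (B × Bit) ℂ :=
  (1 / 2 : ℂ) • (Matrix.blockDiagonal (fun z => 1 - (V z)ᴴ * V z) +
    (controlRow ![V 0, s • V 1])ᴴ * controlRow ![V 0, s • V 1])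

theorem posSemidef_coherenceTest [Fintype T] [Fintype B] [DecidableEq B] {V : Bit → Matrix T B ℂ}
    (hV : ∀ z, (1 - (V z)ᴴ * V z).PosSemidef) (s : ℂ) : (coherenceTest V s).PosSemidef :=
  ((posSemidef_blockDiagonal hV).add (Matrix.posSemidef_conjTranspose_mul_self _)).smul
    (by norm_num [Complex.nonneg_iff])

theorem coherenceTest_add [Fintype T] [DecidableEq B] (V : Bit → Matrix T B ℂ) :
    coherenceTest V 1 + coherenceTest V (-1) = 1 := by
  have h : ∀ s : ℂ, (controlRow ![V 0, s • V 1])ᴴ * controlRow ![V 0, s • V 1] =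
      Matrix.of fun p q => ((![V 0, s • V 1] p.2)ᴴ * ![V 0, s • V 1] q.2) p.1 q.1 := by
    intro s; ext p q; simp [controlRow, Matrix.mul_apply]
  rw [coherenceTest, coherenceTest, h, h]
  ext ⟨β, z⟩ ⟨γ, z'⟩
  fin_cases z <;> fin_cases z' <;>
    simp [Matrix.blockDiagonal_apply, Matrix.one_apply] <;> ring

/-- The probability of Alice's effect `O` together with the coherence test, in the unnormalised
superposition of `v 0` and `v 1`. -/
theorem trace_coherenceTest [Fintype S] [Fintype T] [Fintype B] [DecidableEq B] {O : Matrix S S ℂ} (hO : O.IsHermitian) (V : Bit → Matrix T B ℂ)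
    (v : Bit → Matrix S B ℂ) {s : ℝ} (hs : s * s = 1) :
    ((controlRow v)ᴴ * O * controlRow v * coherenceTest V s).trace.re =
      1 / 2 * (expect O (v 0) + expect O (v 1)) +
        s * coherence O (V 0) (V 1) (v 0) (v 1) := by
  have hsc : (s : ℂ) * s = 1 := by exact_mod_cast hs
  set L := controlRow ![V 0, (s : ℂ) • V 1] with hL
  have h1 : ((controlRow v)ᴴ * O * controlRow v * coherenceTest V s).trace =
      (1 / 2 : ℂ) * ((O * (controlRow v * Matrix.blockDiagonal (fun z => 1 - (V z)ᴴ * V z) *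
        (controlRow v)ᴴ)).trace +
        (O * (controlRow v * Lᴴ * (controlRow v * Lᴴ)ᴴ)).trace) := by
    rw [coherenceTest, ← hL, Matrix.mul_smul, Matrix.trace_smul, Matrix.mul_add, Matrix.trace_add,
      smul_eq_mul]
    congr 2
    · rw [Matrix.mul_assoc, Matrix.mul_assoc, Matrix.trace_mul_comm]
      simp only [Matrix.mul_assoc]
    · rw [Matrix.mul_assoc, Matrix.mul_assoc, Matrix.trace_mul_comm]
      simp only [Matrix.conjTranspose_mul, Matrix.conjTranspose_conjTranspose, Matrix.mul_assoc]
  have h2 : ∀ a : Matrix S B ℂ, (aᴴ * O * a).trace = (O * (a * aᴴ)).trace := fun a => by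
    rw [Matrix.mul_assoc, Matrix.trace_mul_comm, Matrix.mul_assoc]
  have h3 : (V 0 * ((v 0)ᴴ * O * v 1) * (V 1)ᴴ).trace =
      (O * (v 1 * (V 1)ᴴ * (V 0 * (v 0)ᴴ))).trace := by
    have : V 0 * ((v 0)ᴴ * O * v 1) * (V 1)ᴴ = (V 0 * (v 0)ᴴ) * (O * (v 1 * (V 1)ᴴ)) := by
      simp only [Matrix.mul_assoc]
    rw [this, Matrix.trace_mul_comm]
    simp only [Matrix.mul_assoc]
  have h4 : (O * (v 0 * (V 0)ᴴ * (V 1 * (v 1)ᴴ))).trace =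
      star (O * (v 1 * (V 1)ᴴ * (V 0 * (v 0)ᴴ))).trace := by
    rw [← Matrix.trace_conjTranspose, Matrix.trace_mul_comm]
    simp only [Matrix.conjTranspose_mul, Matrix.conjTranspose_conjTranspose, hO.eq,
      Matrix.mul_assoc]
  rw [h1, controlRow_mul_blockDiagonal, controlRow_mul_conjTranspose, hL,
    controlRow_mul_conjTranspose, expect, expect, coherence, h2, h2, h3]
  set c := (O * (v 1 * (V 1)ᴴ * (V 0 * (v 0)ᴴ))).trace with hc
  have h5 : (O * (v 0 * (1 - (V 0)ᴴ * V 0) * (v 0)ᴴ + v 1 * (1 - (V 1)ᴴ * V 1) * (v 1)ᴴ)).trace +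
      (O * ((v 0 * (![V 0, (s : ℂ) • V 1] 0)ᴴ + v 1 * (![V 0, (s : ℂ) • V 1] 1)ᴴ) *
        (v 0 * (![V 0, (s : ℂ) • V 1] 0)ᴴ + v 1 * (![V 0, (s : ℂ) • V 1] 1)ᴴ)ᴴ)).trace =
      (O * (v 0 * (v 0)ᴴ)).trace + (O * (v 1 * (v 1)ᴴ)).trace + s * (star c + c) := by
    rw [← h4, hc]
    simp only [Matrix.cons_val_zero, Matrix.cons_val_one, Matrix.conjTranspose_add,
      Matrix.conjTranspose_mul, Matrix.conjTranspose_smul, Matrix.conjTranspose_conjTranspose,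
      Matrix.mul_add, Matrix.add_mul, Matrix.mul_sub, Matrix.sub_mul, Matrix.mul_one,
      Matrix.mul_smul, Matrix.smul_mul, Matrix.trace_add, Matrix.trace_sub, Matrix.trace_smul,
      smul_eq_mul, Matrix.mul_assoc, Complex.star_def, Complex.conj_ofReal]
    linear_combination (O * (v 1 * ((V 1)ᴴ * (V 1 * (v 1)ᴴ)))).trace * hsc
  rw [h5]
  simp [Complex.add_re, Complex.mul_re]
  ring

end ControlBit

/-! ### The tradeoff between the two cheating strategies -/

section Tradeoff

/-- The data bits with bit `i` equal to `y` and the other bit equal to `z`. -/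
def dataBits (i y z : Bit) : DataBits := fun j => if j = i then y else z

theorem dataBits_self (i y z : Bit) : dataBits i y z i = y := if_pos rfl

theorem dataBits_add_one (i y z : Bit) : dataBits i y z (i + 1) = z := by
  revert i y z; decide

theorem bit_add_one_ne (i : Bit) : i + 1 ≠ i := by revert i; decide

theorem bit_eq_zero_or_one (i : Bit) : i = 0 ∨ i = 1 := by revert i; decide

theorem eq_add_one_of_ne {i j : Bit} (h : i ≠ j) : i = j + 1 := by revert i j; decide

theorem sum_bit {R : Type} [AddCommMonoid R] (i : Bit) (g : Bit → R) :
    ∑ j, g j = g i + g (i + 1) := by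
  rw [Fin.sum_univ_two]
  rcases bit_eq_zero_or_one i with rfl | rfl
  · rfl
  · exact add_comm _ _

theorem sum_dataBits {R : Type} [AddCommMonoid R] (i : Bit) (g : DataBits → R) :
    ∑ x, g x = ∑ y, ∑ z, g (dataBits i y z) := by
  rw [← Fintype.sum_prod_type']
  refine (Fintype.sum_bijective (fun p : Bit × Bit => dataBits i p.1 p.2) ?_ _ _ fun _ => rfl).symm
  revert i; decide

variable {S B : Type} [Fintype S] [DecidableEq S] [Fintype B] [DecidableEq B]

/-- The tradeoff in a form common to both kinds of protocol. Here `v i x` is the final honest state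
for data bits `x`, weighted such that the outputs `(i, y)`, with effects `O i y`, have total
probability `1 / 2` for each `i`. The hypothesis `hA` bounds a cheating Alice who refines her honest
effects in order to guess the other bit; `hB` bounds a cheating Bob who runs the honest program with
data bits `x z` for a control bit `z` in uniform superposition, which is the origin of the factor
`1 / 2`. -/
theorem tradeoff {δ PA PB : ℝ} (v : Bit → DataBits → Matrix S B ℂ)
    (O : Bit → Bit → Matrix S S ℂ) (hO : ∀ i y, (O i y).PosSemidef)
    (hhalf : ∀ i x, ∑ y, expect (O i y) (v i x) = 1 / 2)
    (hcorrect : ∀ x, 1 - δ ≤ ∑ i, expect (O i (x i)) (v i x))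
    (hA : ∀ D : Bit → Bit → Bit → Matrix S S ℂ, (∀ i y z, (D i y z).PosSemidef) →
      (∀ i y, ∑ z, D i y z = O i y) →
      1 / 4 * ∑ i, ∑ y, ∑ z, expect (D i y z) (v i (dataBits i y z)) ≤ PA)
    (hB : ∀ (x : Bit → DataBits) (M : POVM Bit (B × Bit)),
      1 / 2 * ∑ j, ∑ k, ((controlRow fun z => v j (x z))ᴴ * O j k *
        (controlRow fun z => v j (x z)) * (M.effect j)ᵀ).trace.re ≤ PB) :
    2 ≤ PA + 2 * PB + 4 * √δ := by
  have hnn : ∀ i y x, 0 ≤ expect (O i y) (v i x) := fun i y x => expect_nonneg (hO i y) _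
  have hle : ∀ i y x, expect (O i y) (v i x) ≤ 1 / 2 := fun i y x =>
    (hhalf i x) ▸ Finset.single_le_sum (f := fun y => expect (O i y) (v i x))
      (fun k _ => hnn i k x) (Finset.mem_univ y)
  -- The probability of a wrong output is at most `δ` in total, hence also for each `i`.
  have herr : ∀ i y x, y ≠ x i → expect (O i y) (v i x) ≤ δ := by
    intro i y x hy
    have h1 := hhalf i x
    have h2 := hcorrect x
    have h3 := hle 0 (x 0) x
    have h4 := hle 1 (x 1) x
    have h5 : ∑ k, expect (O i k) (v i x) = expect (O i y) (v i x) + expect (O i (x i)) (v i x) := by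
      rw [sum_bit (x i), eq_add_one_of_ne hy, add_comm]
    rw [Fin.sum_univ_two] at h2
    rcases bit_eq_zero_or_one i with rfl | rfl <;> linarith
  have hδ : 0 ≤ δ := (hnn 0 _ (fun _ => 0)).trans (herr 0 1 (fun _ => 0) (by decide))
  have hsδ := Real.sqrt_nonneg δ
  -- An output that is wrong for one of `x`, `x'` has little coherence between the two states.
  have hcoh : ∀ (i k : Bit) (V W : Matrix S B ℂ) (x x' : DataBits), (1 - Vᴴ * V).PosSemidef →
      (1 - Wᴴ * W).PosSemidef → (k ≠ x i ∨ k ≠ x' i) →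
      |coherence (O i k) V W (v i x) (v i x')| ≤ √δ := by
    intro i k V W x x' hV hW hk
    refine (abs_coherence_le (hO i k) hV hW _ _).trans ?_
    have h1 : ∀ x, √(expect (O i k) (v i x)) ≤ 1 := fun x =>
      Real.sqrt_le_one.mpr ((hle i k x).trans (by norm_num))
    rcases hk with hk | hk
    · have := Real.sqrt_le_sqrt (herr i k x hk)
      calc _ ≤ √δ * 1 := mul_le_mul this (h1 _) (Real.sqrt_nonneg _) hsδ
        _ = _ := mul_one _
    · have := Real.sqrt_le_sqrt (herr i k x' hk)
      calc _ ≤ 1 * √δ := mul_le_mul (h1 _) this (Real.sqrt_nonneg _) zero_le_one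
        _ = _ := one_mul _
  choose K hK using fun i y => exists_eq_conjTranspose_mul_self (hO i y)
  choose D₀ D₁ V W h0 h1 hsum hV hW hdisc using fun i y => exists_discriminator_conj (K i y)
    (v i (dataBits i y 0)) (v i (dataBits i y 1))
  simp only [← hK] at hsum hdisc
  set f : Bit → Bit → ℝ := fun i y => coherence (O i y) (V i y) (W i y)
    (v i (dataBits i y 0)) (v i (dataBits i y 1)) with hf
  have hPA := hA (fun i y => ![D₀ i y, D₁ i y])
    (by intro i y z; fin_cases z; exacts [h0 i y, h1 i y])
    (by intro i y; simpa using hsum i y)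
  simp only [Fin.sum_univ_two (f := fun z : Bit => expect (![D₀ _ _, D₁ _ _] z) _),
    Matrix.cons_val_zero, Matrix.cons_val_one] at hPA
  -- Bob's guess is `i` if the coherence test passes and the other index if it fails. Besides `f i y`,
  -- his gain contains three coherences, each of an output that is wrong in one of the two branches.
  have hPB : ∀ i y, 1 / 2 + 1 / 2 * f i y - 3 / 2 * √δ ≤ PB := by
    intro i y
    let X : Bit → Matrix S B ℂ := ![V i y, W i y]
    have hX : ∀ z, (1 - (X z)ᴴ * X z).PosSemidef := by
      intro z; fin_cases z; exacts [hV i y, hW i y]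
    let s : Bit → ℝ := fun j => if j = i then 1 else -1
    let M : POVM Bit (B × Bit) :=
      { effect := fun j => (coherenceTest X (s j))ᵀ
        posSemidef := fun j => (posSemidef_coherenceTest hX _).transpose
        sum_eq_one := by
          rw [← Matrix.transpose_sum, ← Matrix.transpose_one, sum_bit i, ← coherenceTest_add X]
          simp [s] }
    have hM := hB (fun z => dataBits i y z) M
    have hs : ∀ j, s j * s j = 1 := fun j => by simp only [s]; split_ifs <;> norm_num
    have hs1 : s i = 1 := by simp [s]
    have hs2 : s (i + 1) = -1 := by
      simp only [s]; rw [if_neg (bit_add_one_ne i)]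
    simp only [M, Matrix.transpose_transpose, trace_coherenceTest (hO _ _).1 X _ (hs _)] at hM
    simp only [Finset.sum_add_distrib, ← Finset.mul_sum, hhalf] at hM
    rw [sum_bit i, sum_bit i, hs1, hs2] at hM
    simp only [sum_bit y, X, Matrix.cons_val_zero, Matrix.cons_val_one] at hM
    have b1 := hcoh i (y + 1) (V i y) (W i y) (dataBits i y 0) (dataBits i y 1) (hV i y) (hW i y)
      (Or.inl (by rw [dataBits_self]; exact bit_add_one_ne y))
    have b2 : ∀ k, |coherence (O (i + 1) k) (V i y) (W i y) (v (i + 1) (dataBits i y 0))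
        (v (i + 1) (dataBits i y 1))| ≤ √δ := fun k =>
      hcoh (i + 1) k (V i y) (W i y) (dataBits i y 0) (dataBits i y 1) (hV i y) (hW i y)
        (by rw [dataBits_add_one, dataBits_add_one]; clear * - k; revert k; decide)
    have b3 := b2 y
    have b4 := b2 (y + 1)
    rw [abs_le] at b1 b3 b4
    simp only [hf]
    linarith [b1.1, b3.2, b4.2]
  have hcorr : ∑ i, ∑ y, (expect (O i y) (v i (dataBits i y 0)) +
      expect (O i y) (v i (dataBits i y 1))) ≥ 4 * (1 - √δ) := by
    -- For `δ ≤ 1` this follows from `δ ≤ √δ`, and otherwise the left-hand side is not positive.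
    have h1 : ∀ x, 1 - √δ ≤ ∑ i, expect (O i (x i)) (v i x) := by
      intro x
      rcases le_total δ 1 with h | h
      · have : δ ≤ √δ := Real.le_sqrt_of_sq_le (by nlinarith)
        linarith [hcorrect x]
      · have : 1 ≤ √δ := Real.one_le_sqrt.mpr h
        have := Finset.sum_nonneg fun i (_ : i ∈ Finset.univ) => hnn i (x i) x
        linarith
    have h2 : ∑ _x : DataBits, (1 - √δ) = 4 * (1 - √δ) := by simp; ring
    rw [ge_iff_le, ← h2]
    refine (Finset.sum_le_sum fun x _ => h1 x).trans ?_
    rw [Finset.sum_comm]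
    refine Finset.sum_le_sum fun i _ => ?_
    rw [sum_dataBits i]
    refine Finset.sum_le_sum fun y _ => ?_
    rw [Fin.sum_univ_two]
    simp [dataBits]
  simp only [Fin.sum_univ_two] at hPA hcorr
  linarith [hdisc 0 0, hdisc 0 1, hdisc 1 0, hdisc 1 1, hPB 0 0, hPB 0 1, hPB 1 0, hPB 1 1]

end Tradeoff

/-! ### Joint states as matrices -/

section States

variable {S RA A B : Type} [Fintype S] [Fintype RA] [Fintype A] [Fintype B]

/-- A joint vector as a matrix, with rows indexed by Alice's memory and the message and columns by
Bob's memory. -/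
def stateMatrix (φ : RA × A × B → ℂ) : Matrix (RA × A) B ℂ :=
  Matrix.of fun s β => φ (s.1, s.2, β)

theorem dotProduct_eq_trace (φ χ : RA × A × B → ℂ) :
    star φ ⬝ᵥ χ = ((stateMatrix φ)ᴴ * stateMatrix χ).trace := by
  simp only [dotProduct, Matrix.trace, Matrix.mul_apply, stateMatrix, Fintype.sum_prod_type,
    Matrix.diag_apply, Matrix.conjTranspose_apply, Matrix.of_apply, Pi.star_apply]
  conv_rhs => rw [Finset.sum_comm]
  exact Finset.sum_congr rfl fun r _ => Finset.sum_comm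

theorem stateMatrix_aliceBob_mulVec (X : Matrix (RA × A) (RA × A) ℂ) (Y : Matrix B B ℂ)
    (φ : RA × A × B → ℂ) :
    stateMatrix (aliceBob X Y *ᵥ φ) = X * stateMatrix φ * Yᵀ := by
  ext s β
  simp only [stateMatrix, aliceBob, Matrix.mulVec, dotProduct, Matrix.mul_apply, Matrix.of_apply,
    Fintype.sum_prod_type, Matrix.reindex_apply, Matrix.submatrix_apply, Equiv.prodAssoc_symm_apply,
    Matrix.kroneckerMap_apply, Matrix.transpose_apply, Finset.sum_mul]
  rw [Finset.sum_comm' (t' := Finset.univ) (s' := fun _ => Finset.univ) (by simp)]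
  conv_rhs => rw [Finset.sum_comm]
  conv_lhs => rw [Finset.sum_comm]
  refine Finset.sum_congr rfl fun r _ => ?_
  rw [Finset.sum_comm]
  exact Finset.sum_congr rfl fun _ _ => Finset.sum_congr rfl fun _ _ => by ring

theorem aliceBob_one_mulVec [DecidableEq B] (X : Matrix (RA × A) (RA × A) ℂ)
    (φ : RA × A × B → ℂ) (r : RA) (m : A) (β : B) :
    (aliceBob X 1 *ᵥ φ) (r, m, β) = ∑ t, X (r, m) t * φ (t.1, t.2, β) := by
  have h := congrFun₂ (stateMatrix_aliceBob_mulVec X 1 φ) (r, m) β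
  rw [Matrix.transpose_one, Matrix.mul_one] at h
  exact h

theorem prob_aliceBob (X : Matrix (RA × A) (RA × A) ℂ) (Y : Matrix B B ℂ) (φ : RA × A × B → ℂ) :
    prob φ (aliceBob X Y) =
      ((stateMatrix φ)ᴴ * X * stateMatrix φ * Yᵀ).trace.re := by
  rw [prob, dotProduct_eq_trace, stateMatrix_aliceBob_mulVec]
  simp only [Matrix.mul_assoc]

theorem prob_aliceBob_one [DecidableEq B] (X : Matrix (RA × A) (RA × A) ℂ) (φ : RA × A × B → ℂ) :
    prob φ (aliceBob X 1) = expect X (stateMatrix φ) := by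
  rw [prob_aliceBob, Matrix.transpose_one, Matrix.mul_one, expect]

theorem prob_aliceBob_add (X X' : Matrix (RA × A) (RA × A) ℂ) (Y : Matrix B B ℂ)
    (φ : RA × A × B → ℂ) :
    prob φ (aliceBob (X + X') Y) = prob φ (aliceBob X Y) + prob φ (aliceBob X' Y) := by
  simp [prob_aliceBob, Matrix.mul_add, Matrix.add_mul]

theorem prob_aliceBob_nonneg {X : Matrix (RA × A) (RA × A) ℂ} {Y : Matrix B B ℂ}
    (hX : X.PosSemidef) (hY : Y.PosSemidef) (φ : RA × A × B → ℂ) :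
    0 ≤ prob φ (aliceBob X Y) := by
  rw [prob_aliceBob]
  exact re_trace_mul_nonneg (hX.conjTranspose_mul_mul_same _) hY.transpose

/-- A unit vector on which the product of a projection of Alice and a projection of Bob has
expectation `1` is fixed by both projections. -/
theorem eq_of_accept {P : Matrix S S ℂ} {Q : Matrix B B ℂ} (hP : IsStarProjection P)
    (hQ : IsStarProjection Q) {m : Matrix S B ℂ} (hm : (mᴴ * m).trace = 1)
    (h : (mᴴ * P * m * Qᵀ).trace.re = 1) : P * m = m ∧ m * Qᵀ = m := by
  have hP1 : Pᴴ = P := hP.isSelfAdjoint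
  have hP2 : P * P = P := hP.isIdempotentElem
  have hQ2 : Qᵀ * Qᵀ = Qᵀ := by rw [← Matrix.transpose_mul, hQ.isIdempotentElem.eq]
  have hQ1 : (Qᵀ)ᴴ = Qᵀ := by
    have : Qᴴ = Q := hQ.isSelfAdjoint
    rw [show (Qᵀ)ᴴ = (Qᴴ)ᵀ from rfl, this]
  have hn : m - P * m * Qᵀ = 0 := by
    rw [← Matrix.trace_conjTranspose_mul_self_eq_zero_iff]
    have e1 : ((P * m * Qᵀ)ᴴ * (P * m * Qᵀ)).trace = (mᴴ * P * m * Qᵀ).trace := by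
      have : (P * m * Qᵀ)ᴴ * (P * m * Qᵀ) = Qᵀ * (mᴴ * (P * P) * m * Qᵀ) := by
        simp only [Matrix.conjTranspose_mul, hP1, hQ1, Matrix.mul_assoc]
      rw [this, hP2, Matrix.trace_mul_comm, Matrix.mul_assoc _ Qᵀ, hQ2]
    have e2 : ((P * m * Qᵀ)ᴴ * m).trace = (mᴴ * P * m * Qᵀ).trace := by
      have : (P * m * Qᵀ)ᴴ * m = Qᵀ * (mᴴ * P * m) := by
        simp only [Matrix.conjTranspose_mul, hP1, hQ1, Matrix.mul_assoc]
      rw [this, Matrix.trace_mul_comm]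
    have e3 : (mᴴ * (P * m * Qᵀ)).trace = (mᴴ * P * m * Qᵀ).trace := by
      simp only [Matrix.mul_assoc]
    have e : ((m - P * m * Qᵀ)ᴴ * (m - P * m * Qᵀ)).trace = 1 - (mᴴ * P * m * Qᵀ).trace := by
      rw [Matrix.conjTranspose_sub, Matrix.sub_mul, Matrix.mul_sub, Matrix.mul_sub,
        Matrix.trace_sub, Matrix.trace_sub, Matrix.trace_sub, e1, e2, e3, hm]
      ring
    have h0 := Complex.nonneg_iff.mp
      (Matrix.posSemidef_conjTranspose_mul_self (m - P * m * Qᵀ)).trace_nonneg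
    refine Complex.ext ?_ h0.2.symm
    rw [e, Complex.sub_re, h]; simp
  rw [sub_eq_zero] at hn
  constructor
  · nth_rewrite 1 [hn]
    rw [Matrix.mul_assoc, ← Matrix.mul_assoc, hP2, ← Matrix.mul_assoc, ← hn]
  · nth_rewrite 1 [hn]
    rw [Matrix.mul_assoc, hQ2, ← hn]

end States

/-! ### Cheating strategies in the protocols -/

section Protocols

variable {N : ℕ} {A RA RB : Type} [Fintype A] [DecidableEq A] [Fintype RA] [DecidableEq RA]
  [Fintype RB] [DecidableEq RB]

theorem dotProduct_unitary_mulVec {S : Type} [Fintype S] [DecidableEq S] {U : Matrix S S ℂ}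
    (hU : Uᴴ * U = 1) (φ : S → ℂ) : star (U *ᵥ φ) ⬝ᵥ (U *ᵥ φ) = star φ ⬝ᵥ φ := by
  rw [Matrix.star_mulVec, ← Matrix.dotProduct_mulVec, Matrix.mulVec_mulVec, hU, Matrix.one_mulVec]

theorem dotProduct_stateAfter (a : AliceProgram N A RA) (b : BobProgram N A RB) (ℓ : ℕ)
    (h : ℓ ≤ N) : star (stateAfter a b ℓ h) ⬝ᵥ stateAfter a b ℓ h = 1 := by
  induction ℓ with
  | zero =>
    have ha := a.init_unit
    have hb := b.init_unit
    calc _ = (star a.init ⬝ᵥ a.init) * (star b.init ⬝ᵥ b.init) := by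
          simp only [dotProduct, Fintype.sum_prod_type, stateAfter, Pi.star_apply, star_mul',
            Finset.sum_mul]
          refine Finset.sum_congr rfl fun _ _ => Finset.sum_congr rfl fun _ _ => ?_
          rw [Finset.mul_sum]
          exact Finset.sum_congr rfl fun _ _ => by ring
      _ = 1 := by rw [ha, hb, one_mul]
  | succ ℓ ih =>
    have hU : (onBob (RA := RA) (b.U ⟨ℓ, h⟩ : Matrix (A × RB) (A × RB) ℂ))ᴴ *
        onBob (b.U ⟨ℓ, h⟩ : Matrix (A × RB) (A × RB) ℂ) = 1 := by
      have : (b.U ⟨ℓ, h⟩ : Matrix (A × RB) (A × RB) ℂ)ᴴ * (b.U ⟨ℓ, h⟩ : Matrix _ _ ℂ) = 1 :=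
        Matrix.mem_unitaryGroup_iff'.mp (b.U ⟨ℓ, h⟩).2
      rw [onBob, Matrix.conjTranspose_kronecker, ← Matrix.mul_kronecker_mul, this]
      simp
    have hV : (aliceBob (a.V ⟨ℓ, h⟩ : Matrix (RA × A) (RA × A) ℂ) (1 : Matrix RB RB ℂ))ᴴ *
        aliceBob (a.V ⟨ℓ, h⟩ : Matrix (RA × A) (RA × A) ℂ) (1 : Matrix RB RB ℂ) = 1 := by
      have : (a.V ⟨ℓ, h⟩ : Matrix (RA × A) (RA × A) ℂ)ᴴ * (a.V ⟨ℓ, h⟩ : Matrix _ _ ℂ) = 1 :=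
        Matrix.mem_unitaryGroup_iff'.mp (a.V ⟨ℓ, h⟩).2
      rw [aliceBob, Matrix.conjTranspose_reindex, Matrix.reindex_apply, Matrix.reindex_apply,
        Matrix.submatrix_mul_equiv, Matrix.conjTranspose_kronecker, ← Matrix.mul_kronecker_mul,
        this]
      simp
    rw [stateAfter, dotProduct_unitary_mulVec hV, dotProduct_unitary_mulVec hU, ih]

/-- A cheating Bob who runs the honest program in superposition: a control bit `z` in the state
`(|0⟩ + |1⟩) / √2` selects the data bits `x z`. -/
noncomputable def HonestBob.superposed (b : HonestBob N A RB) (x : Bit → DataBits) :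
    BobProgram N A (RB × Bit) where
  init p := ((√2 : ℝ) : ℂ)⁻¹ * Pi.single (M := fun _ => ℂ) b.zero 1 p.1
  init_unit := by
    have h2 : ((√2 : ℝ) : ℂ) * ((√2 : ℝ) : ℂ) = 2 := by
      rw [← Complex.ofReal_mul, Real.mul_self_sqrt (by norm_num)]; norm_num
    simp only [dotProduct, Fintype.sum_prod_type, Pi.star_apply, Pi.single_apply]
    simp [← mul_inv, h2]
  U ℓ := ⟨Matrix.reindex (Equiv.prodAssoc A RB Bit) (Equiv.prodAssoc A RB Bit)
      (Matrix.blockDiagonal fun z => (b.U (x z) ℓ : Matrix (A × RB) (A × RB) ℂ)), by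
    rw [Matrix.mem_unitaryGroup_iff', Matrix.star_eq_conjTranspose, Matrix.conjTranspose_reindex,
      Matrix.reindex_apply, Matrix.reindex_apply, Matrix.submatrix_mul_equiv,
      Matrix.blockDiagonal_conjTranspose, ← Matrix.blockDiagonal_mul]
    have : (fun z => (b.U (x z) ℓ : Matrix (A × RB) (A × RB) ℂ)ᴴ * (b.U (x z) ℓ : Matrix _ _ ℂ))
        = 1 := funext fun z => Matrix.mem_unitaryGroup_iff'.mp (b.U (x z) ℓ).2
    rw [this, Matrix.blockDiagonal_one]
    simp⟩

theorem HonestBob.superposed_apply (b : HonestBob N A RB) (x : Bit → DataBits) (ℓ : Fin N)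
    (m m' : A) (β β' : RB) (z z' : Bit) :
    ((b.superposed x).U ℓ : Matrix (A × RB × Bit) (A × RB × Bit) ℂ) (m, β, z) (m', β', z') =
      if z = z' then ((b.program (x z)).U ℓ : Matrix (A × RB) (A × RB) ℂ) (m, β) (m', β')
      else 0 :=
  rfl

theorem stateAfter_superposed (a : AliceProgram N A RA) (b : HonestBob N A RB)
    (x : Bit → DataBits) (ℓ : ℕ) (h : ℓ ≤ N) (r : RA) (m : A) (β : RB) (z : Bit) :
    stateAfter a (b.superposed x) ℓ h (r, m, β, z) =
      ((√2 : ℝ) : ℂ)⁻¹ * stateAfter a (b.program (x z)) ℓ h (r, m, β) := by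
  induction ℓ generalizing r m β z with
  | zero =>
    simp only [stateAfter, HonestBob.superposed, HonestBob.program]
    ring
  | succ ℓ ih =>
    have h1 : ∀ r m β z, (onBob ((b.superposed x).U ⟨ℓ, h⟩ : Matrix (A × RB × Bit) _ ℂ) *ᵥ
          stateAfter a (b.superposed x) ℓ (Nat.le_of_succ_le h)) (r, m, β, z) =
        ((√2 : ℝ) : ℂ)⁻¹ * (onBob ((b.program (x z)).U ⟨ℓ, h⟩ : Matrix (A × RB) _ ℂ) *ᵥ
          stateAfter a (b.program (x z)) ℓ (Nat.le_of_succ_le h)) (r, m, β) := by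
      intro r m β z
      simp only [Matrix.mulVec, dotProduct, Fintype.sum_prod_type, onBob, Matrix.kroneckerMap_apply,
        ih, HonestBob.superposed_apply, Finset.mul_sum]
      refine Finset.sum_congr rfl fun r' _ => Finset.sum_congr rfl fun m' _ =>
        Finset.sum_congr rfl fun β' _ => ?_
      rw [Finset.sum_eq_single z (fun z' _ hz => by rw [if_neg (Ne.symm hz)]; ring) (by simp),
        if_pos rfl]
      ring
    simp only [stateAfter, aliceBob_one_mulVec, h1, Finset.mul_sum]
    exact Finset.sum_congr rfl fun _ _ => mul_left_comm _ _ _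

theorem stateMatrix_superposed (a : AliceProgram N A RA) (b : HonestBob N A RB)
    (x : Bit → DataBits) :
    stateMatrix (finalState a (b.superposed x)) =
      ((√2 : ℝ) : ℂ)⁻¹ • controlRow fun z => stateMatrix (finalState a (b.program (x z))) := by
  ext s ⟨β, z⟩
  exact stateAfter_superposed a b x N le_rfl s.1 s.2 β z

theorem conjTranspose_smul_mul_smul {S B : Type} [Fintype S] [Fintype B] (O : Matrix S S ℂ)
    (m : Matrix S B ℂ) :
    (((√2 : ℝ) : ℂ)⁻¹ • m)ᴴ * O * (((√2 : ℝ) : ℂ)⁻¹ • m) = (1 / 2 : ℂ) • (mᴴ * O * m) := by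
  have h2 : ((√2 : ℝ) : ℂ)⁻¹ * ((√2 : ℝ) : ℂ)⁻¹ = 1 / 2 := by
    rw [← mul_inv, ← Complex.ofReal_mul, Real.mul_self_sqrt (by norm_num)]; norm_num
  rw [Matrix.conjTranspose_smul, Matrix.smul_mul, Matrix.smul_mul, Matrix.mul_smul, smul_smul]
  simp [h2]

theorem expect_smul {S B : Type} [Fintype S] [Fintype B] (O : Matrix S S ℂ) (m : Matrix S B ℂ) :
    expect O (((√2 : ℝ) : ℂ)⁻¹ • m) = 1 / 2 * expect O m := by
  rw [expect, conjTranspose_smul_mul_smul, Matrix.trace_smul, expect, smul_eq_mul,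
    show (1 / 2 : ℂ) = ((1 / 2 : ℝ) : ℂ) by norm_num, Complex.re_ofReal_mul]

theorem prob_superposed (a : AliceProgram N A RA) (b : HonestBob N A RB)
    (x : Bit → DataBits) (X : Matrix (RA × A) (RA × A) ℂ) (Y : Matrix (RB × Bit) (RB × Bit) ℂ) :
    prob (finalState a (b.superposed x)) (aliceBob X Y) =
      1 / 2 * ((controlRow fun z => stateMatrix (finalState a (b.program (x z))))ᴴ * X *
        (controlRow fun z => stateMatrix (finalState a (b.program (x z)))) * Yᵀ).trace.re := by
  rw [prob_aliceBob, stateMatrix_superposed, conjTranspose_smul_mul_smul, Matrix.smul_mul,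
    Matrix.trace_smul, smul_eq_mul, show (1 / 2 : ℂ) = ((1 / 2 : ℝ) : ℂ) by norm_num,
    Complex.re_ofReal_mul]

theorem posSemidef_sandwich {S : Type} [Fintype S] {P M : Matrix S S ℂ}
    (hP : IsStarProjection P) (hM : M.PosSemidef) : (P * M * P).PosSemidef := by
  have h := hM.conjTranspose_mul_mul_same P
  rwa [show Pᴴ = P from hP.isSelfAdjoint] at h

/-- When both parties accept with certainty, Bob's projection can be dropped from all
probabilities, and Alice's projection has expectation `1`. -/
theorem prob_of_accept (a : AliceProgram N A RA) (b : BobProgram N A RB)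
    {P : Matrix (RA × A) (RA × A) ℂ} {Q : Matrix RB RB ℂ} (hP : IsStarProjection P)
    (hQ : IsStarProjection Q) (h : prob (finalState a b) (aliceBob P Q) = 1) :
    (∀ X, prob (finalState a b) (aliceBob X Q) = expect X (stateMatrix (finalState a b))) ∧
      expect P (stateMatrix (finalState a b)) = 1 := by
  have hm := dotProduct_stateAfter a b N le_rfl
  rw [dotProduct_eq_trace] at hm
  rw [prob_aliceBob] at h
  obtain ⟨h1, h2⟩ := eq_of_accept hP hQ hm h
  constructor
  · intro X
    rw [prob_aliceBob, Matrix.mul_assoc, show stateMatrix (finalState a b) * Qᵀ = _ from h2]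
    rfl
  · rw [expect, Matrix.mul_assoc]
    change ((stateMatrix (stateAfter a b N le_rfl))ᴴ *
      (P * stateMatrix (stateAfter a b N le_rfl))).trace.re = 1
    rw [show P * stateMatrix (stateAfter a b N le_rfl) = _ from h1, hm, Complex.one_re]

/-- Soundness against a cheating Alice for a measurement whose effects need not sum to `1`: the
remaining effect is added to an arbitrary outcome. -/
theorem HonestBob.SoundAgainstAlice.of_subPOVM {B : HonestBob N A RB} {PA : ℝ}
    (hB : B.SoundAgainstAlice PA) (a : AliceProgram N A RA)
    (E : DataBits → Matrix (RA × A) (RA × A) ℂ) (hE : ∀ x, (E x).PosSemidef)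
    (hsum : (1 - ∑ x, E x).PosSemidef) :
    1 / 4 * ∑ x, prob (finalState a (B.program x)) (aliceBob (E x) (B.accept x)) ≤ PA := by
  let R : DataBits → Matrix (RA × A) (RA × A) ℂ := fun x => if x = 0 then 1 - ∑ x, E x else 0
  have hR : ∀ x, (R x).PosSemidef := by
    intro x; simp only [R]; split_ifs
    exacts [hsum, Matrix.PosSemidef.zero]
  refine le_trans ?_ (hB RA a ⟨fun x => E x + R x, fun x => (hE x).add (hR x), ?_⟩)
  · refine mul_le_mul_of_nonneg_left (Finset.sum_le_sum fun x _ => ?_) (by norm_num)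
    rw [prob_aliceBob_add]
    linarith [prob_aliceBob_nonneg (hR x) (posSemidef_of_isStarProjection (B.accept_proj x))
      (finalState a (B.program x))]
  · rw [Finset.sum_add_distrib]
    simp [R]

theorem SemiRandomOT.tradeoff {δ PA PB : ℝ} (P : SemiRandomOT N A RA RB) (hc : P.Complete δ)
    (hA : P.bob.SoundAgainstAlice PA) (hB : P.SoundAgainstBob PB) :
    2 ≤ PA + 2 * PB + 4 * √δ := by
  have hO : ∀ i y, (P.outputEffect i y).PosSemidef := fun i y =>
    posSemidef_sandwich P.aliceAccept_proj (P.aliceMeas.posSemidef _)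
  have hOsum : ∑ i, ∑ y, P.outputEffect i y = P.aliceAccept := by
    have h := P.aliceMeas.sum_eq_one
    rw [Fintype.sum_prod_type] at h
    simp only [outputEffect, ← Finset.sum_mul, ← Finset.mul_sum]
    rw [h, mul_one, P.aliceAccept_proj.isIdempotentElem.eq]
  have hacc := fun x => prob_of_accept P.alice (P.bob.program x) P.aliceAccept_proj
    (P.bob.accept_proj x) (hc x).1
  refine QOT.tradeoff (fun _ x => stateMatrix (finalState P.alice (P.bob.program x)))
    P.outputEffect hO (fun i x => ?_) (fun x => ?_) (fun D hD hDsum => ?_) (fun x M => ?_)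
  · simpa only [prob_aliceBob_one] using (hc x).2.1 i
  · simpa only [prob_aliceBob_one] using (hc x).2.2
  · have h := hA.of_subPOVM P.alice (fun x => ∑ i, D i (x i) (x (i + 1)))
      (fun x => Matrix.posSemidef_sum _ fun i _ => hD _ _ _) (by
        rw [Finset.sum_comm]
        rw [Finset.sum_congr rfl fun i _ => sum_dataBits i fun x => D i (x i) (x (i + 1))]
        simp only [dataBits_self, dataBits_add_one, hDsum, hOsum]
        exact posSemidef_of_isStarProjection P.aliceAccept_proj.one_sub)
    simp only [(hacc _).1, expect_sum] at h
    rw [Finset.sum_comm, Finset.sum_congr rfl fun i _ => sum_dataBits i fun x =>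
      expect (D i (x i) (x (i + 1))) (stateMatrix (finalState P.alice (P.bob.program x)))] at h
    simpa only [dataBits_self, dataBits_add_one] using h
  · have h := hB (RB × Bit) (P.bob.superposed x) M
    simpa only [prob_superposed, ← Finset.mul_sum] using h

theorem StandardOT.tradeoff {δ PA PB : ℝ} (P : StandardOT N A RA RB) (hc : P.Complete δ)
    (hA : P.bob.SoundAgainstAlice PA) (hB : P.SoundAgainstBob PB) :
    2 ≤ PA + 2 * PB + 4 * √δ := by
  have hO : ∀ i y, (P.outputEffect i y).PosSemidef := fun i y =>
    posSemidef_sandwich (P.aliceAccept_proj i) ((P.aliceMeas i).posSemidef _)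
  have hOsum : ∀ i, ∑ y, P.outputEffect i y = P.aliceAccept i := by
    intro i
    simp only [outputEffect, ← Finset.sum_mul, ← Finset.mul_sum]
    rw [(P.aliceMeas i).sum_eq_one, mul_one, (P.aliceAccept_proj i).isIdempotentElem.eq]
  have hacc := fun i x => prob_of_accept (P.alice i) (P.bob.program x) (P.aliceAccept_proj i)
    (P.bob.accept_proj x) (hc i x).1
  -- The factor `1 / √2` accounts for the uniformly random input `i`.
  refine QOT.tradeoff
    (fun i x => ((√2 : ℝ) : ℂ)⁻¹ • stateMatrix (finalState (P.alice i) (P.bob.program x)))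
    P.outputEffect hO (fun i x => ?_) (fun x => ?_) (fun D hD hDsum => ?_) (fun x M => ?_)
  · rw [← expect_sum, hOsum, expect_smul, (hacc i x).2, mul_one]
  · have h := fun i => (hc i x).2
    simp only [prob_aliceBob_one] at h
    simp only [expect_smul, Fin.sum_univ_two]
    linarith [h 0, h 1]
  · have h := fun i => hA.of_subPOVM (P.alice i) (fun x => D i (x i) (x (i + 1)))
      (fun x => hD _ _ _) (by
        rw [sum_dataBits i]
        simp only [dataBits_self, dataBits_add_one, hDsum, hOsum]
        exact posSemidef_of_isStarProjection (P.aliceAccept_proj i).one_sub)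
    have h' : ∀ i, 1 / 4 * ∑ y, ∑ z, expect (D i y z)
        (stateMatrix (finalState (P.alice i) (P.bob.program (dataBits i y z)))) ≤ PA := by
      intro i
      have h := h i
      simp only [(hacc _ _).1] at h
      rw [sum_dataBits i] at h
      simpa only [dataBits_self, dataBits_add_one] using h
    simp only [expect_smul, ← Finset.mul_sum]
    rw [Fin.sum_univ_two (f := fun i : Bit => ∑ y, ∑ z, _)]
    linarith [h' 0, h' 1]
  · have h := hB (RB × Bit) (P.bob.superposed x) M
    have hrow : ∀ j, (controlRow fun z => ((√2 : ℝ) : ℂ)⁻¹ •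
        stateMatrix (finalState (P.alice j) (P.bob.program (x z)))) =
        stateMatrix (finalState (P.alice j) (P.bob.superposed x)) := fun j => by
      rw [stateMatrix_superposed]; rfl
    simp only [hrow, ← prob_aliceBob]
    refine le_of_eq_of_le ?_ h
    congr 1
    refine Finset.sum_congr rfl fun j _ => ?_
    rw [← hOsum j]
    simp only [prob_aliceBob, Matrix.mul_sum, Matrix.sum_mul, Matrix.trace_sum, Complex.re_sum]

end Protocols

end QOT

theorem mainTheorem2 {N : ℕ} {A RA RB : Type} [Fintype A] [DecidableEq A] [Fintype RA]
    [DecidableEq RA] [Fintype RB] [DecidableEq RB] (δ PA PB : ℝ) :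
    (∀ P : QOT.SemiRandomOT N A RA RB,
      P.Complete δ → P.bob.SoundAgainstAlice PA → P.SoundAgainstBob PB →
        2 ≤ PA + 2 * PB + 4 * √δ) ∧
    (∀ P : QOT.StandardOT N A RA RB,
      P.Complete δ → P.bob.SoundAgainstAlice PA → P.SoundAgainstBob PB →
        2 ≤ PA + 2 * PB + 4 * √δ) :=
  ⟨fun P => P.tradeoff, fun P => P.tradeoff⟩
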